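/- **Setting.** Let $k\ge 1$. A $k$-web $\mathcal W$ on the complex projective plane $\mathbb P^2$ is given by a section $\omega\in H^0(\mathbb P^2,\mathrm{Sym}^k\Omega^1_{\mathbb P^2}\otimes N)$, with $N$ a line bundle, whose zero set is finite (possibly empty) and such that, for $p$ outside a proper closed hypersurface, $\omega(p)$ is a product of $k$ linear forms on $T_p\mathbb P^2$, pairwise distinct up to scalars; two sections define the same web iff they differ by a nonzero constant. The discriminant of $\mathcal W$ is the set of points $p$ at which $\omega(p)$ is not such a product. The degree $\deg(\mathcal W)$ is the number of tangencies of $\mathcal W$ with a generic line, that is, the degree of the divisor of zeros of $\iota^*\omega$ for a generic linear embedding $\iota:\mathbb P^1\to\mathbb P^2$. Let $\phi:\mathbb P^2\to\mathbb P^2$ be an endomorphism, given by three homogeneous polynomials of the same degree without common zero in $\mathbb C^3\setminus\{0\}$. Let $\Delta_\phi$ be its ramification divisor (locally defined by $\det D\phi=0$). The critical values of $\phi$ are the points of the image under $\phi$ of the support of $\Delta_\phi$. For an irreducible curve $C\subset\mathbb P^2$ let $m(C)$ be the vanishing order of $\phi^*\omega$ along $C$. The web $\mathcal W$ is invariant by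 $\phi$ if $\phi^*\mathcal W=\mathcal W$, that is, if $\phi^*\omega$ is not identically zero and, divided by an equation of its divisor of zeros, is a section defining $\mathcal W$. **Proposition.** Let $\mathcal W$ be a $k$-web on $\mathbb P^2$ that is invariant by a non-invertible endomorphism $\phi:\mathbb P^2\to\mathbb P^2$. Then $\deg(\mathcal W)$ is well defined and $$\deg(\mathcal W)\le k .$$ Moreover, $\deg(\mathcal W)=k$ if and only if $m(C)=k\,\mathrm{ord}_C(\Delta_\phi)$ for every irreducible curve $C\subset\mathbb P^2$. If $k\ge2$ and $\deg(\mathcal W)=k$, then the set of critical values of $\phi$, hence each of its irreducible components, is contained in the discriminant of $\mathcal W$. -/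

import Mathlib

open scoped LinearAlgebra.Projectivization

noncomputable section

/-- The complex projective plane (as the set of its closed points). -/
abbrev P2 : Type := ℙ ℂ (Fin 3 → ℂ)

/-- The complex projective line. -/
abbrev P1 : Type := ℙ ℂ (Fin 2 → ℂ)

/-- Polynomial symmetric differential forms on `ℂⁿ`: polynomials in `dx₁, …, dxₙ` (the outer
variables) whose coefficients are polynomials in the coordinates `x₁, …, xₙ`. -/
abbrev SymForm (n : ℕ) : Type := MvPolynomial (Fin n) (MvPolynomial (Fin n) ℂ)

namespace SymForm

/-- The value `η(x)(v)` of a symmetric form at the point `x` on the tangent vector `v`. -/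
def val {n : ℕ} (η : SymForm n) (x v : Fin n → ℂ) : ℂ :=
  MvPolynomial.eval v (MvPolynomial.map (MvPolynomial.eval x) η)

/-- Pull-back of symmetric forms by the polynomial map `F : ℂᵐ → ℂⁿ`:
`xᵢ ↦ Fᵢ` and `dxᵢ ↦ dFᵢ = ∑ⱼ (∂Fᵢ/∂xⱼ) dxⱼ`. -/
def pullback {m n : ℕ} (F : Fin n → MvPolynomial (Fin m) ℂ) : SymForm n →+* SymForm m :=
  MvPolynomial.eval₂Hom
    (MvPolynomial.C.comp (MvPolynomial.aeval F).toRingHom)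
    (fun i => ∑ j, MvPolynomial.C (MvPolynomial.pderiv j (F i)) * MvPolynomial.X j)

/-- Contraction `i_R η` of `η` with the radial (Euler) vector field `R = ∑ xᵢ ∂/∂xᵢ`. -/
def contractRadial {n : ℕ} (η : SymForm n) : SymForm n :=
  ∑ i, MvPolynomial.C (MvPolynomial.X i) * MvPolynomial.pderiv i η

/-- The vanishing order of `η` along the hypersurface `{P = 0}`, for `P` irreducible: the largest
`r` such that `P ^ r` divides (all coefficients of) `η`, and `⊤` if `η = 0`. -/
def ordAlong {n : ℕ} (P : MvPolynomial (Fin n) ℂ) (η : SymForm n) : ℕ∞ :=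
  emultiplicity (MvPolynomial.C P) η

/-- `η` represents, in homogeneous coordinates, a global section of
`Sym^k Ω¹ ⊗ 𝒪(e + k)` over the projective plane: it has degree `k` in the differentials, its
coefficients are homogeneous of degree `e`, and it descends to the tangent spaces
`T_{[x]} P² ≅ ℂ³ / ℂ x`, that is, its contraction with the radial field is zero. -/
structure IsTwistedSection (η : SymForm 3) (k e : ℕ) : Prop where
  homogeneous : η.IsHomogeneous k
  coeff_homogeneous : ∀ d, (η.coeff d).IsHomogeneous e
  radial : η.contractRadial = 0

/-- At the point `[x]` the `k`-symmetric form `η` is a product of `k` (nonzero) linear forms on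
`T_{[x]} P² ≅ ℂ³ / ℂ x`, no two of which are proportional. -/
def IsDistinctProductAt (η : SymForm 3) (k : ℕ) (x : Fin 3 → ℂ) : Prop :=
  ∃ l : Fin k → ((Fin 3 → ℂ) →ₗ[ℂ] ℂ),
    (∀ i, l i x = 0 ∧ l i ≠ 0) ∧
    (∀ i j, i ≠ j → LinearIndependent ℂ ![l i, l j]) ∧
    ∀ v, η.val x v = ∏ i, l i v

end SymForm

/-- A (singular) `k`-web on the projective plane, through a section `form` of `Sym^k Ω¹ ⊗ N`
defining it, where `N = 𝒪(coeffDegree + k)`: the zero set of the section is finite (codimension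
two, if not empty), and outside a proper closed hypersurface the section is a product of `k`
pairwise distinct linear forms. (Two sections define the same web if and only if they differ by a
nonzero constant.) -/
structure Web (k : ℕ) where
  form : SymForm 3
  coeffDegree : ℕ
  isTwistedSection : form.IsTwistedSection k coeffDegree
  finite_zeros : {p : P2 | ∀ v, form.val p.rep v = 0}.Finite
  generically_distinct : ∃ (Q : MvPolynomial (Fin 3) ℂ) (r : ℕ), Q ≠ 0 ∧ Q.IsHomogeneous r ∧
    ∀ p : P2, MvPolynomial.eval p.rep Q ≠ 0 → form.IsDistinctProductAt k p.rep

namespace Web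

variable {k : ℕ}

/-- The discriminant curve of a web: the set of points at which its defining section is not a
product of `k` pairwise distinct linear forms. -/
def discriminant (W : Web k) : Set P2 :=
  {p | ¬ W.form.IsDistinctProductAt k p.rep}

/-- The pull-back `ι^* ω` of the section defining `W` to the projective line, for the linear map
`ι : ℂ² → ℂ³` with matrix `A`. -/
def restrictLine (W : Web k) (A : Matrix (Fin 3) (Fin 2) ℂ) : SymForm 2 :=
  SymForm.pullback (fun i => ∑ j, MvPolynomial.C (A i j) * MvPolynomial.X j) W.form

/-- The number of tangencies `deg (ι^* ω)₀` of `W` with the line parametrized by `ι`: the sum over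
the points `q = [q₀ : q₁]` of the projective line of the vanishing order of `ι^* ω` at `q`, the
point `q` having the equation `q₁ s - q₀ t = 0`. -/
def tangencies (W : Web k) (A : Matrix (Fin 3) (Fin 2) ℂ) : ℕ∞ :=
  ∑' q : P1, SymForm.ordAlong
    (MvPolynomial.C (q.rep 1) * MvPolynomial.X 0 - MvPolynomial.C (q.rep 0) * MvPolynomial.X 1)
    (W.restrictLine A)

/-- `W` has degree `n`: a generic line has exactly `n` tangencies with `W`, where generic means
that the linear embedding lies outside a proper Zariski-closed subset. -/
def HasDegree (W : Web k) (n : ℕ) : Prop :=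
  ∃ Q : MvPolynomial (Fin 3 × Fin 2) ℂ, Q ≠ 0 ∧
    ∀ A : Matrix (Fin 3) (Fin 2) ℂ, Function.Injective A.mulVec →
      MvPolynomial.eval (fun ij => A ij.1 ij.2) Q ≠ 0 → W.tangencies A = n

end Web

/-- An endomorphism of the projective plane: three homogeneous polynomials of the same degree
without common zero outside the origin. -/
structure P2Endo where
  degree : ℕ
  lift : Fin 3 → MvPolynomial (Fin 3) ℂ
  homogeneous : ∀ i, (lift i).IsHomogeneous degree
  no_common_zero : ∀ x : Fin 3 → ℂ, x ≠ 0 → (fun i => MvPolynomial.eval x (lift i)) ≠ 0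

namespace P2Endo

/-- The map on the points of the projective plane. -/
def toFun (φ : P2Endo) (p : P2) : P2 :=
  Projectivization.mk ℂ (fun i => MvPolynomial.eval p.rep (φ.lift i))
    (φ.no_common_zero p.rep p.rep_nonzero)

/-- `φ` is invertible: it has an inverse endomorphism, so it is an automorphism of the plane. -/
def IsInvertible (φ : P2Endo) : Prop :=
  ∃ ψ : P2Endo, (∀ p, ψ.toFun (φ.toFun p) = p) ∧ (∀ p, φ.toFun (ψ.toFun p) = p)

/-- The homogeneous equation of the ramification divisor `Δ_φ`, which is locally defined by the
Jacobian determinant of `φ`. It is the Jacobian determinant of the homogeneous lift: by Euler's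
identity the Jacobian determinant of `φ`, from the affine chart `xᵢ = 1` to the affine chart
`yⱼ ≠ 0`, is `± det(∂Φ) / (degree * Φⱼ ^ 3)` where `xᵢ = 1`. -/
def jacobian (φ : P2Endo) : MvPolynomial (Fin 3) ℂ :=
  (Matrix.of fun i j => MvPolynomial.pderiv j (φ.lift i)).det

/-- `ord_C(Δ_φ)` for the curve `C = {P = 0}`, `P` irreducible and homogeneous. -/
def ordRamification (φ : P2Endo) (P : MvPolynomial (Fin 3) ℂ) : ℕ∞ :=
  emultiplicity P φ.jacobian

/-- The set of critical values: the image of the critical set, the support of `Δ_φ`. -/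
def criticalValues (φ : P2Endo) : Set P2 :=
  φ.toFun '' {p : P2 | MvPolynomial.eval p.rep φ.jacobian = 0}

variable {k : ℕ}

/-- The pull-back `φ^* ω` of the section `ω` defining the web `W`. -/
def pullbackForm (φ : P2Endo) (W : Web k) : SymForm 3 :=
  SymForm.pullback φ.lift W.form

/-- `m(C) = m(φ, W, C)` for the curve `C = {P = 0}`, `P` irreducible and homogeneous: the vanishing
order of `φ^* ω` along `C`. -/
def vanishingMult (φ : P2Endo) (W : Web k) (P : MvPolynomial (Fin 3) ℂ) : ℕ∞ :=
  SymForm.ordAlong P (φ.pullbackForm W)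

/-- `W` is invariant by `φ`, that is `φ^* W = W`: the nonzero form `φ^* ω`, divided by an equation
`h` of the divisor of its zeros, is a section defining `W`. -/
def LeavesInvariant (φ : P2Endo) (W : Web k) : Prop :=
  ∃ h : MvPolynomial (Fin 3) ℂ, h ≠ 0 ∧ φ.pullbackForm W = MvPolynomial.C h * W.form

end P2Endo

end

/-! Write `ω` for the form of the web, `e` for its coefficient degree, `Φ` for the lift of `φ`, `D`
for its degree and `J` for its Jacobian determinant. Restricted to a line on which it is not
identically zero, `ω` becomes `c (s dt - t ds)^k` with `c` a binary form of degree `e - k`. The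
tangencies are the zeros of `c`, so the degree of the web is `n = e - k`.

Invariance reads `Φ^* ω = h ω`, and comparing degrees gives `deg h = (D - 1)(n + 2k)`. Evaluating
this identity on `adj(DΦ) u` gives `J^k ω(Φ(x))(u) = h(x) ω(x)(adj(DΦ) u)`, so `h` divides `J^k
ω(Φ)(u)` for every `u`. No prime factor of `h` divides all the polynomials `ω(Φ)(u)`, because `φ`
contracts no curve to finitely many points whereas `ω` has finitely many zeros. Hence `J^k = h g`.
Since `deg J = 3(D - 1)`, the cofactor `g` has degree `(D - 1)(k - n)`. As `J ≠ 0` and `D ≥ 2`, this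
gives `n ≤ k`, with equality exactly when `g` is constant, that is, when the divisor of `h` is `k
Δ_φ`.

In that case `h` cancels and `ω(Φ(x))(u)` is a constant times `ω(x)(adj(DΦ) u)`. At a critical point
the adjugate has rank at most one, so `ω` at the critical value is a multiple of the `k`-th power of
one linear form. For `k ≥ 2` this is not a product of pairwise independent forms.

The main steps are `Web.exists_hasDegree_iff`, `P2Endo.exists_isHomogeneous_of_pullbackForm_eq`,
`P2Endo.dvd_jacobian_pow` and `P2Endo.criticalValues_subset_discriminant`. -/

noncomputable section

namespace MvPolynomial

/-! ### Factors of homogeneous polynomials -/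

section HomogeneousFactors

variable {σ R : Type*} [CommRing R]

/-- The grading of a polynomial ring, as the ring homomorphism `p ↦ ∑ pₙ tⁿ`. -/
def gradingHom (σ R : Type*) [CommRing R] :
    MvPolynomial σ R →ₐ[R] Polynomial (MvPolynomial σ R) :=
  aeval fun i => Polynomial.C (X i) * Polynomial.X

theorem gradingHom_monomial (d : σ →₀ ℕ) (r : R) :
    gradingHom σ R (monomial d r) = Polynomial.C (monomial d r) * Polynomial.X ^ d.degree := by
  rw [gradingHom, aeval_monomial, Finsupp.prod]
  simp_rw [mul_pow]
  rw [Finset.prod_mul_distrib, Finset.prod_pow_eq_pow_sum, monomial_eq, Finsupp.prod]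
  simp only [← map_pow, ← map_prod]
  rw [Polynomial.C_mul, ← mul_assoc]
  rfl

theorem coeff_gradingHom (p : MvPolynomial σ R) (n : ℕ) :
    (gradingHom σ R p).coeff n = homogeneousComponent n p := by
  induction p using MvPolynomial.induction_on' with
  | monomial d r =>
    rw [gradingHom_monomial, Polynomial.coeff_C_mul_X_pow]
    split_ifs with h
    · rw [homogeneousComponent_eq_self (isHomogeneous_monomial r h.symm)]
    · rw [homogeneousComponent_of_mem (isHomogeneous_monomial r rfl), if_neg]
      exact h
  | add p q hp hq => simp [hp, hq]

theorem gradingHom_injective : Function.Injective (gradingHom σ R) := by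
  rw [injective_iff_map_eq_zero]
  intro p hp
  rw [← sum_homogeneousComponent p]
  refine Finset.sum_eq_zero fun i _ => ?_
  rw [← coeff_gradingHom, hp, Polynomial.coeff_zero]

theorem IsHomogeneous.gradingHom_eq {p : MvPolynomial σ R} {n : ℕ} (hp : p.IsHomogeneous n) :
    gradingHom σ R p = Polynomial.C p * Polynomial.X ^ n := by
  ext1 i
  rw [coeff_gradingHom, homogeneousComponent_of_mem hp, Polynomial.coeff_C_mul_X_pow]

/-- A factor of a nonzero homogeneous polynomial is homogeneous. -/
theorem IsHomogeneous.exists_of_mul [IsDomain R] {p q : MvPolynomial σ R} {m : ℕ}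
    (h : (p * q).IsHomogeneous m) (h0 : p * q ≠ 0) :
    ∃ a b, p.IsHomogeneous a ∧ q.IsHomogeneous b ∧ a + b = m := by
  have hp0 : gradingHom σ R p ≠ 0 :=
    (map_ne_zero_iff _ gradingHom_injective).2 (left_ne_zero_of_mul h0)
  have hq0 : gradingHom σ R q ≠ 0 :=
    (map_ne_zero_iff _ gradingHom_injective).2 (right_ne_zero_of_mul h0)
  have key := h.gradingHom_eq
  rw [map_mul] at key
  -- Over a domain the highest and the lowest `t`-degree are both additive. They agree for the
  -- product, hence for each factor.
  have h1 := congrArg Polynomial.natDegree key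
  have h2 := congrArg Polynomial.natTrailingDegree key
  rw [Polynomial.natDegree_mul hp0 hq0, Polynomial.natDegree_C_mul_X_pow _ _ h0] at h1
  rw [Polynomial.natTrailingDegree_mul hp0 hq0, Polynomial.C_mul_X_pow_eq_monomial,
    Polynomial.natTrailingDegree_monomial h0] at h2
  have h3 := Polynomial.natTrailingDegree_le_natDegree (gradingHom σ R p)
  have h4 := Polynomial.natTrailingDegree_le_natDegree (gradingHom σ R q)
  have hom : ∀ f : MvPolynomial σ R, (gradingHom σ R f).natTrailingDegree =
      (gradingHom σ R f).natDegree → f.IsHomogeneous (gradingHom σ R f).natDegree := by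
    intro f hf
    rw [← sum_homogeneousComponent f]
    refine IsHomogeneous.sum _ _ _ fun i _ => ?_
    by_cases hi : i = (gradingHom σ R f).natDegree
    · rw [sum_homogeneousComponent, ← hi]; exact homogeneousComponent_isHomogeneous _ _
    · rw [sum_homogeneousComponent, ← coeff_gradingHom]
      rcases lt_or_gt_of_ne hi with hlt | hlt
      · rw [Polynomial.coeff_eq_zero_of_lt_natTrailingDegree (hf ▸ hlt)]
        exact isHomogeneous_zero _ _ _
      · rw [Polynomial.coeff_eq_zero_of_natDegree_lt hlt]
        exact isHomogeneous_zero _ _ _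
  exact ⟨_, _, hom p (by omega), hom q (by omega), h1⟩

end HomogeneousFactors

theorem IsHomogeneous.eval_smul {σ R : Type*} [CommSemiring R] [Finite σ] {p : MvPolynomial σ R} {n : ℕ}
    (hp : p.IsHomogeneous n) (c : R) (x : σ → R) : eval (c • x) p = c ^ n * eval x p := by
  cases nonempty_fintype σ
  simp only [eval_eq', Finset.mul_sum]
  refine Finset.sum_congr rfl fun d hd => ?_
  have hd' : ∑ i, d i = n := by
    rw [← hp (mem_support_iff.1 hd), Finsupp.weight_apply, Finsupp.sum_fintype] <;> simp
  simp only [Pi.smul_apply, smul_eq_mul, mul_pow, Finset.prod_mul_distrib]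
  rw [Finset.prod_pow_eq_pow_sum, hd']
  ring

theorem IsHomogeneous.eval_zero_of_ne_zero {σ R : Type*} [CommSemiring R] {p : MvPolynomial σ R} {n : ℕ}
    (hp : p.IsHomogeneous n) (hn : n ≠ 0) : eval (0 : σ → R) p = 0 := by
  rw [eval_zero, constantCoeff_eq]
  exact hp.coeff_eq_zero (by simpa using hn.symm)

/-! ### Consequences of the Nullstellensatz -/

/-- A prime polynomial divides the polynomials vanishing on its zero set. -/
theorem dvd_of_forall_eval_eq_zero {σ K : Type*} [Field K] [IsAlgClosed K] [Finite σ]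
    {P f : MvPolynomial σ K} (hP : Prime P) (h : ∀ x, eval x P = 0 → eval x f = 0) : P ∣ f := by
  have : (Ideal.span {P}).IsPrime := (Ideal.span_singleton_prime hP.ne_zero).2 hP
  rw [← Ideal.mem_span_singleton, ← IsPrime.vanishingIdeal_zeroLocus (K := K) (Ideal.span {P})]
  intro x hx
  rw [zeroLocus_span] at hx
  simpa using h x (by simpa using hx)

theorem exists_pow_mem_span_of_zeroLocus {σ K : Type*} [Field K] [IsAlgClosed K] [Finite σ]
    {S : Set (MvPolynomial σ K)} {f : MvPolynomial σ K}
    (h : ∀ x, (∀ p ∈ S, eval x p = 0) → eval x f = 0) : ∃ n : ℕ, f ^ n ∈ Ideal.span S := by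
  have : f ∈ vanishingIdeal K (zeroLocus K (Ideal.span S)) := by
    intro x hx
    rw [zeroLocus_span] at hx
    simpa using h x (by simpa using hx)
  rwa [vanishingIdeal_zeroLocus_eq_radical] at this

/-! ### Krull height and intersections of surfaces in `ℂ³` -/

section Height

/-- The substitution of `0` for the variables with index less than `j`. -/
def zeroBelow (j : ℕ) : MvPolynomial (Fin 3) ℂ →ₐ[ℂ] MvPolynomial (Fin 3) ℂ :=
  aeval fun i => if i.val < j then 0 else X i

/-- These kernels form the chain `(0) < (X₀) < (X₀, X₁) < (X₀, X₁, X₂)`. As kernels of maps to a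
domain they are automatically prime. -/
theorem ker_zeroBelow_lt {j : ℕ} (hj : j < 3) :
    RingHom.ker (zeroBelow j) < RingHom.ker (zeroBelow (j + 1)) := by
  refine lt_of_le_of_ne (fun p hp => ?_) fun h => ?_
  · have : (zeroBelow (j + 1)).comp (zeroBelow j) = zeroBelow (j + 1) := by
      ext i
      simp only [zeroBelow, AlgHom.comp_apply, aeval_X]
      by_cases hi : i.val < j
      · simp [hi, Nat.lt_succ_of_lt hi]
      · simp [hi]
    rw [RingHom.mem_ker] at hp ⊢
    rw [← this, AlgHom.comp_apply, hp, map_zero]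
  · have h1 : (X ⟨j, hj⟩ : MvPolynomial (Fin 3) ℂ) ∈ RingHom.ker (zeroBelow (j + 1)) := by
      simp [RingHom.mem_ker, zeroBelow]
    rw [← h, RingHom.mem_ker] at h1
    simp [zeroBelow] at h1

theorem three_le_height_ker_zeroBelow : 3 ≤ (RingHom.ker (zeroBelow 3)).height := by
  have h : ∀ j : ℕ, j ≤ 3 → (j : ℕ∞) ≤ (RingHom.ker (zeroBelow j)).height := by
    intro j
    induction j with
    | zero => simp
    | succ j ih =>
      intro hj
      have := RingHom.ker_isPrime (zeroBelow j)
      have := RingHom.ker_isPrime (zeroBelow (j + 1))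
      refine le_trans ?_ (Ideal.height_add_one_le_of_lt_of_isPrime (ker_zeroBelow_lt hj))
      push_cast
      gcongr
      exact ih (by omega)
  exact_mod_cast h 3 le_rfl

theorem mem_ker_zeroBelow_three {p : MvPolynomial (Fin 3) ℂ} :
    p ∈ RingHom.ker (zeroBelow 3) ↔ eval 0 p = 0 := by
  have : zeroBelow 3 = (Algebra.ofId ℂ _).comp (aeval 0) := by
    ext i
    simp [zeroBelow]
  rw [RingHom.mem_ker, this, AlgHom.comp_apply, Algebra.ofId_apply, algebraMap_eq, C_eq_zero,
    ← coe_aeval_eq_eval]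
  rfl

/-- Two surfaces through the origin of `ℂ³` meet outside the origin. -/
theorem exists_common_zero {f g : MvPolynomial (Fin 3) ℂ} (hf : eval 0 f = 0) (hg : eval 0 g = 0) :
    ∃ x ≠ 0, eval x f = 0 ∧ eval x g = 0 := by
  by_contra! hcon
  have hprime := RingHom.ker_isPrime (zeroBelow 3)
  have hle : ∀ (J : Ideal (MvPolynomial (Fin 3) ℂ)) [J.IsPrime], Ideal.span {f, g} ≤ J →
      RingHom.ker (zeroBelow 3) ≤ J := by
    intro J hJ hsub p hp
    rw [mem_ker_zeroBelow_three] at hp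
    obtain ⟨n, hn⟩ := exists_pow_mem_span_of_zeroLocus (S := {f, g}) (f := p) (by
      intro x hx
      by_cases hx0 : x = 0
      · rw [hx0, hp]
      · exact absurd (hx g (by simp)) (hcon x hx0 (hx f (by simp))))
    exact hJ.mem_of_pow_mem n (hsub hn)
  -- If the origin were the only common zero, its maximal ideal, of height at least three, would be
  -- minimal over an ideal with two generators, against Krull's height theorem.
  have hmin : RingHom.ker (zeroBelow 3) ∈ (Ideal.span {f, g}).minimalPrimes := by
    refine ⟨⟨hprime, ?_⟩, fun J hJ _ => ?_⟩
    · rw [Ideal.span_le]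
      rintro p (rfl | rfl)
      · exact mem_ker_zeroBelow_three.2 hf
      · exact mem_ker_zeroBelow_three.2 hg
    · have := hJ.1
      exact hle J hJ.2
  classical
  have h2 := Ideal.height_le_card_of_mem_minimalPrimes_span_finset (s := {f, g})
    (by simpa using hmin)
  have h3 := three_le_height_ker_zeroBelow.trans (h2.trans (Nat.cast_le.2 Finset.card_le_two))
  exact absurd h3 (by decide)

end Height

end MvPolynomial

/-! ### Integrality and nonvanishing of the Jacobian determinant -/

/-- Differentiating `g(x) = 0` gives `g'(x) D x = 0`. Either `D x = 0`, or `g'` divided by its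
leading coefficient is a monic equation of smaller degree. The division uses the rational scalars.
-/
theorem Derivation.eq_zero_of_isIntegral {B A : Type*} [CommRing B] [CommRing A] [IsDomain A]
    [Algebra ℚ B] [Algebra B A] (D : Derivation B A A) {x : A} (hx : IsIntegral B x) : D x = 0 := by
  obtain ⟨g, hg, h0⟩ := hx
  rw [← Polynomial.aeval_def] at h0
  induction hn : g.natDegree generalizing g with
  | zero =>
    rw [hg.natDegree_eq_zero.1 hn, map_one] at h0
    exact absurd h0 one_ne_zero
  | succ n ih =>
    have h1 := D.map_aeval g x
    rw [h0, map_zero, smul_eq_mul, eq_comm, mul_eq_zero] at h1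
    refine h1.elim (fun h => ?_) id
    let c : B := algebraMap ℚ B ((n + 1 : ℚ)⁻¹)
    have hc : c * ((n : B) + 1) = 1 := by
      have : ((n : B) + 1) = algebraMap ℚ B (n + 1) := by simp
      rw [this, ← map_mul, inv_mul_cancel₀ (by positivity), map_one]
    have hle : (Polynomial.C c * g.derivative).natDegree ≤ n :=
      (Polynomial.natDegree_C_mul_le _ _).trans
        ((Polynomial.natDegree_derivative_le _).trans (by omega))
    have hcoeff : (Polynomial.C c * g.derivative).coeff n = 1 := by
      rw [Polynomial.coeff_C_mul, Polynomial.coeff_derivative, ← hn, hg.coeff_natDegree, one_mul, hc]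
    have hmonic := Polynomial.monic_of_natDegree_le_of_coeff_eq_one n hle hcoeff
    have : Nontrivial B := (algebraMap B A).domain_nontrivial
    refine ih _ hmonic (by simp [h]) (le_antisymm hle ?_)
    exact Polynomial.le_natDegree_of_ne_zero (by rw [hcoeff]; exact one_ne_zero)

namespace MvPolynomial

variable {σ : Type*}

theorem homogeneousComponent_mul_of_isHomogeneous {R : Type*} [CommRing R] {D : ℕ}
    {F : MvPolynomial σ R} (hF : F.IsHomogeneous D) (a : MvPolynomial σ R) (n : ℕ) :
    homogeneousComponent n (a * F) = if D ≤ n then homogeneousComponent (n - D) a * F else 0 := by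
  rw [← coeff_gradingHom, map_mul, hF.gradingHom_eq, ← mul_assoc, Polynomial.coeff_mul_X_pow']
  split_ifs
  · rw [Polynomial.coeff_mul_C, coeff_gradingHom]
  · rfl

variable [Fintype σ]

/-- A polynomial ring is integral over the subalgebra generated by homogeneous polynomials of the
same positive degree without common zero outside the origin. -/
theorem isIntegral_adjoin_of_no_common_zero {K : Type*} [Field K] [IsAlgClosed K]
    {F : σ → MvPolynomial σ K} {D : ℕ} (hD : D ≠ 0)
    (hF : ∀ i, (F i).IsHomogeneous D) (h0 : ∀ x : σ → K, x ≠ 0 → (fun i => eval x (F i)) ≠ 0)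
    (p : MvPolynomial σ K) : IsIntegral (Algebra.adjoin K (Set.range F)) p := by
  classical
  have hpow : ∀ i : σ, ∃ n : ℕ, (X i : MvPolynomial σ K) ^ n ∈ Ideal.span (Set.range F) := by
    refine fun i => exists_pow_mem_span_of_zeroLocus fun x hx => ?_
    by_cases hx0 : x = 0
    · simp [hx0]
    · refine absurd ?_ (h0 x hx0)
      funext j
      exact hx _ ⟨j, rfl⟩
  choose N hN using hpow
  -- A monomial of degree above `m` is divisible by some `X i ^ N i`, hence lies in the ideal of the
  -- `F j`. So the finitely many monomials of degree at most `m` generate the module, by induction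
  -- on the degree.
  let m := ∑ i, N i
  let S : Set (MvPolynomial σ K) :=
    (fun d : σ →₀ ℕ => monomial d (1 : K)) '' {d | d.degree ≤ m}
  have hS : S.Finite := by
    refine Set.Finite.image _ ((Set.finite_Iic (Finsupp.equivFunOnFinite.symm fun _ => m)).subset ?_)
    intro d hd i
    exact (Finsupp.le_degree i d).trans hd
  let B := Algebra.adjoin K (Set.range F)
  let M : Submodule B (MvPolynomial σ K) := Submodule.span B S
  have hsmulK : ∀ (c : K) (q : MvPolynomial σ K), q ∈ M → C c * q ∈ M := fun c q hq => by
    have := M.smul_mem (algebraMap K B c) hq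
    simpa [Algebra.smul_def] using this
  have hhom : ∀ n (q : MvPolynomial σ K), q.IsHomogeneous n → q ∈ M := by
    intro n
    induction n using Nat.strong_induction_on with
    | _ n ih =>
      intro q hq
      rw [q.as_sum]
      refine M.sum_mem fun d hd => ?_
      have hdn : d.degree = n := by
        by_contra hne
        exact (mem_support_iff.1 hd) (hq.coeff_eq_zero hne)
      rw [← mul_one (coeff d q), ← C_mul_monomial]
      refine hsmulK _ _ ?_
      by_cases hm : d.degree ≤ m
      · exact Submodule.subset_span ⟨d, hm, rfl⟩
      · obtain ⟨i, hi⟩ : ∃ i, N i < d i := by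
          by_contra! hcon
          exact hm (by rw [Finsupp.degree_eq_sum]; exact Finset.sum_le_sum fun i _ => hcon i)
        have hmem : monomial d (1 : K) ∈ Ideal.span (Set.range F) := by
          refine Ideal.mem_of_dvd _ ?_ (hN i)
          rw [X_pow_eq_monomial, monomial_one_dvd_monomial_one]
          simpa using hi.le
        obtain ⟨a, ha⟩ := Ideal.mem_span_range_iff_exists_fun.1 hmem
        -- Taking degree `n` components replaces the coefficients by forms of degree `n - D`, to
        -- which the induction applies.
        have hcomp := congrArg (homogeneousComponent n) ha
        rw [homogeneousComponent_eq_self (isHomogeneous_monomial _ hdn), map_sum] at hcomp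
        rw [← hcomp]
        refine M.sum_mem fun j _ => ?_
        rw [homogeneousComponent_mul_of_isHomogeneous (hF j)]
        split_ifs with hle
        · have h1 := ih (n - D) (by omega) _ (homogeneousComponent_isHomogeneous (n - D) (a j))
          have := M.smul_mem (⟨F j, Algebra.subset_adjoin ⟨j, rfl⟩⟩ : B) h1
          rwa [Algebra.smul_def, mul_comm] at this
        · exact M.zero_mem
  have htop : M = ⊤ := by
    rw [eq_top_iff]
    intro q _
    rw [← sum_homogeneousComponent q]
    exact M.sum_mem fun i _ => hhom i _ (homogeneousComponent_isHomogeneous _ _)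
  have : Module.Finite B (MvPolynomial σ K) := ⟨htop ▸ Submodule.fg_span hS⟩
  exact Algebra.IsIntegral.isIntegral p

/-- The Jacobian determinant of homogeneous polynomials of the same positive degree without common
zero outside the origin does not vanish identically. -/
theorem det_pderiv_ne_zero_of_no_common_zero [DecidableEq σ] {K : Type*} [Field K] [IsAlgClosed K]
    [CharZero K]
    {F : σ → MvPolynomial σ K} {D : ℕ} (hD : D ≠ 0)
    (hF : ∀ i, (F i).IsHomogeneous D) (h0 : ∀ x : σ → K, x ≠ 0 → (fun i => eval x (F i)) ≠ 0) :
    (Matrix.of fun i j => pderiv j (F i)).det ≠ 0 := by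
  intro hdet
  obtain ⟨v, hv, hMv⟩ := Matrix.exists_mulVec_eq_zero_iff.2 hdet
  -- A kernel vector of the Jacobian matrix is a vector field killing every `F i`. It is then linear
  -- over the subalgebra they generate, so it kills the integral elements `X i`, and its
  -- coefficients vanish.
  let d : Derivation K (MvPolynomial σ K) (MvPolynomial σ K) := ∑ j, v j • pderiv j
  have hd : ∀ p, d p = ∑ j, v j * pderiv j p := fun p => by
    have := congrFun (map_sum Derivation.coeFnAddMonoidHom (fun j => v j • pderiv j) Finset.univ) p
    refine Eq.trans this ?_
    rw [Finset.sum_apply]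
    rfl
  have hdF : ∀ b ∈ Algebra.adjoin K (Set.range F), d b = 0 := by
    refine fun b hb => Derivation.eqOn_adjoin (D1 := d) (D2 := 0) ?_ hb
    rintro _ ⟨i, rfl⟩
    have := congrFun hMv i
    simp only [Matrix.mulVec, dotProduct, Matrix.of_apply, Pi.zero_apply] at this
    rw [hd, Derivation.coe_zero, Pi.zero_apply, ← this]
    exact Finset.sum_congr rfl fun j _ => mul_comm _ _
  let dB : Derivation (Algebra.adjoin K (Set.range F)) (MvPolynomial σ K) (MvPolynomial σ K) :=
    { toFun := d
      map_add' := map_add d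
      map_smul' := fun b p => by
        simp [Algebra.smul_def, hdF b b.2]
      map_one_eq_zero' := d.map_one_eq_zero
      leibniz' := d.leibniz }
  apply hv
  funext i
  let _ : Algebra ℚ (Algebra.adjoin K (Set.range F)) :=
    ((algebraMap K _).comp (algebraMap ℚ K)).toAlgebra
  have h1 : dB (X i) = 0 := dB.eq_zero_of_isIntegral (isIntegral_adjoin_of_no_common_zero hD hF h0 _)
  have h2 : d (X i) = 0 := h1
  rw [hd] at h2
  simpa [pderiv_X, Pi.single_apply] using h2

end MvPolynomial

open MvPolynomial

/-! ### Evaluation, substitution and pull-back of symmetric forms -/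

/-- The chain rule for a derivation and a polynomial substitution. -/
theorem Derivation.map_mvPolynomial_aeval {R A σ : Type*} [CommRing R] [CommRing A] [Algebra R A]
    [Fintype σ] (D : Derivation R A A) (f : σ → A) (p : MvPolynomial σ R) :
    D (aeval f p) = ∑ i, aeval f (pderiv i p) * D (f i) := by
  classical
  induction p using MvPolynomial.induction_on with
  | C a => simp
  | add p q hp hq => simp [hp, hq, add_mul, Finset.sum_add_distrib]
  | mul_X p j hp =>
    simp only [map_mul, aeval_X, Derivation.leibniz, hp, pderiv_X, smul_eq_mul, map_add, add_mul,
      Finset.sum_add_distrib, Finset.mul_sum]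
    congr 1
    · rw [Finset.sum_eq_single j]
      · simp
      · intro i _ hi
        simp [hi.symm]
      · simp
    · exact Finset.sum_congr rfl fun i _ => by ring

theorem MvPolynomial.eval_aeval {R σ τ : Type*} [CommSemiring R] (F : σ → MvPolynomial τ R)
    (x : τ → R) (p : MvPolynomial σ R) :
    eval x (aeval F p) = eval (fun i => eval x (F i)) p := by
  induction p using MvPolynomial.induction_on with
  | C a => simp
  | add p q hp hq => rw [map_add, map_add, map_add, hp, hq]
  | mul_X p i hp => rw [map_mul, map_mul, map_mul, hp, aeval_X, eval_X]

namespace SymForm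

/-- Substitution of polynomials for the coordinates and for their differentials. -/
def subst {n : ℕ} {τ : Type*} (η : SymForm n) (F G : Fin n → MvPolynomial τ ℂ) :
    MvPolynomial τ ℂ :=
  eval₂ (aeval F).toRingHom G η

/-- Evaluation of symmetric forms, as a ring homomorphism. -/
def valHom {n : ℕ} (x v : Fin n → ℂ) : SymForm n →+* ℂ :=
  (eval v).comp (map (eval x))

theorem valHom_apply {n : ℕ} (x v : Fin n → ℂ) (η : SymForm n) : valHom x v η = η.val x v := rfl

theorem valHom_X {n : ℕ} (x v : Fin n → ℂ) (i : Fin n) : valHom x v (X i) = v i := by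
  simp [valHom]

theorem valHom_C {n : ℕ} (x v : Fin n → ℂ) (p : MvPolynomial (Fin n) ℂ) :
    valHom x v (C p) = eval x p := by
  simp [valHom]

/-- `subst` turns values of a form into polynomials, so that divisibility and degree make sense for
them. -/
theorem eval_subst {n : ℕ} {τ : Type*} (η : SymForm n) (F G : Fin n → MvPolynomial τ ℂ)
    (x : τ → ℂ) :
    eval x (η.subst F G) = η.val (fun i => eval x (F i)) (fun i => eval x (G i)) := by
  have : (eval x).comp (eval₂Hom (aeval F).toRingHom G) =
      valHom (fun i => eval x (F i)) (fun i => eval x (G i)) := by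
    refine MvPolynomial.ringHom_ext (fun p => ?_) fun i => by simp [valHom_X]
    rw [valHom_C]
    simp only [RingHom.comp_apply, eval₂Hom_C, AlgHom.toRingHom_eq_coe, RingHom.coe_coe]
    exact eval_aeval F x p
  exact RingHom.congr_fun this η

theorem val_pullback {m n : ℕ} (F : Fin n → MvPolynomial (Fin m) ℂ) (η : SymForm n)
    (x v : Fin m → ℂ) :
    (pullback F η).val x v =
      η.val (fun i => eval x (F i)) (fun i => ∑ j, eval x (pderiv j (F i)) * v j) := by
  have : (valHom x v).comp (pullback F) =
      valHom (fun i => eval x (F i)) (fun i => ∑ j, eval x (pderiv j (F i)) * v j) := by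
    refine MvPolynomial.ringHom_ext (fun p => ?_) fun i => ?_
    · rw [valHom_C]
      simp only [pullback, RingHom.comp_apply, eval₂Hom_C, AlgHom.toRingHom_eq_coe, RingHom.coe_coe,
        valHom_C]
      exact eval_aeval F x p
    · simp [pullback, valHom_X, valHom_C]
  exact RingHom.congr_fun this η

/-- As `ℂ` is infinite, polynomials are determined by their values at both levels. Identities of
forms can therefore be checked pointwise. -/
theorem ext_val {n : ℕ} {η θ : SymForm n} (h : ∀ x v, η.val x v = θ.val x v) : η = θ := by
  ext1 d
  refine MvPolynomial.funext fun x => ?_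
  have : map (eval x) η = map (eval x) θ := MvPolynomial.funext (h x)
  simpa only [coeff_map] using congrArg (coeff d) this

theorem val_C_mul {n : ℕ} (p : MvPolynomial (Fin n) ℂ) (η : SymForm n) (x v : Fin n → ℂ) :
    (C p * η : SymForm n).val x v = eval x p * η.val x v := by
  rw [← valHom_apply, map_mul, valHom_C, valHom_apply]

theorem subst_isHomogeneous {n k e p q : ℕ} {τ : Type*} {η : SymForm n}
    (hk : η.IsHomogeneous k) (he : ∀ d, (η.coeff d).IsHomogeneous e)
    {F G : Fin n → MvPolynomial τ ℂ} (hF : ∀ i, (F i).IsHomogeneous p)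
    (hG : ∀ i, (G i).IsHomogeneous q) : (η.subst F G).IsHomogeneous (p * e + q * k) := by
  rw [subst, eval₂_eq']
  refine IsHomogeneous.sum _ _ _ fun d hd => ?_
  refine ((he d).aeval F hF).mul ?_
  have hd' : ∑ i, d i = k := by
    rw [← hk (mem_support_iff.1 hd), Finsupp.weight_apply, Finsupp.sum_fintype] <;> simp
  rw [← hd', Finset.mul_sum]
  exact IsHomogeneous.prod _ _ _ fun i _ => (hG i).pow _

theorem val_smul_right {n k : ℕ} {η : SymForm n} (hk : η.IsHomogeneous k) (c : ℂ)
    (x v : Fin n → ℂ) : η.val x (c • v) = c ^ k * η.val x v :=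
  (hk.map (eval x)).eval_smul c v

theorem val_smul_left {n e : ℕ} {η : SymForm n} (he : ∀ d, (η.coeff d).IsHomogeneous e) (c : ℂ)
    (x v : Fin n → ℂ) : η.val (c • x) v = c ^ e * η.val x v := by
  have : map (eval (c • x)) η = C (c ^ e) * map (eval x) η := by
    ext1 d
    rw [coeff_C_mul, coeff_map, coeff_map, (he d).eval_smul]
  rw [val, this, map_mul, eval_C, val]

/-- A form annihilated by the radial field descends to the quotient by the radial direction. -/
theorem val_add_smul_of_contractRadial {n : ℕ} {η : SymForm n} (h : η.contractRadial = 0)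
    (x v : Fin n → ℂ) (t : ℂ) : η.val x (v + t • x) = η.val x v := by
  let f : Fin n → Polynomial ℂ := fun i => Polynomial.C (v i) + Polynomial.C (x i) * Polynomial.X
  let p : Polynomial ℂ := aeval f (map (eval x) η)
  have heval : ∀ s (q : MvPolynomial (Fin n) ℂ), (aeval f q).eval s = eval (v + s • x) q := by
    intro s q
    have : (Polynomial.aeval s).comp (aeval f) = aeval (v + s • x) := by
      ext i
      simp only [AlgHom.comp_apply, aeval_X, f]
      simp [mul_comm s]
    have := AlgHom.congr_fun this q
    rw [AlgHom.comp_apply, Polynomial.coe_aeval_eq_eval] at this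
    exact this
  -- The derivative of `s ↦ η(x)(v + s x)` is the value of the radial contraction at `v + s x`.
  have hd : Polynomial.derivative p = 0 := by
    refine Polynomial.funext fun s => ?_
    have h1 := Polynomial.derivative'.map_mvPolynomial_aeval f (map (eval x) η)
    rw [Polynomial.derivative'_apply] at h1
    rw [h1, Polynomial.eval_finsetSum, Polynomial.eval_zero, ← map_zero (valHom x (v + s • x)), ← h,
      contractRadial, map_sum]
    refine Finset.sum_congr rfl fun i _ => ?_
    rw [map_mul, valHom_C, valHom_apply, val, Polynomial.eval_mul, heval, pderiv_map]
    simp only [f]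
    simp [mul_comm (x i)]
  have hp := Polynomial.derivative_eq_zero.1 hd
  rw [Polynomial.natDegree_eq_zero] at hp
  obtain ⟨c, hc⟩ := hp
  have h1 := heval t (map (eval x) η)
  have h2 := heval 0 (map (eval x) η)
  rw [show aeval f (map (eval x) η) = Polynomial.C c from hc.symm, Polynomial.eval_C] at h1 h2
  rw [val, ← h1, h2, val, zero_smul, add_zero]

end SymForm

/-! ### Curves are not contracted -/

/-- An endomorphism does not contract a curve to finitely many points. -/
theorem P2Endo.exists_eval_ne_smul (φ : P2Endo) (hD : φ.degree ≠ 0) {P : MvPolynomial (Fin 3) ℂ}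
    (hP : Prime P) (hP0 : eval 0 P = 0) (S : Finset (Fin 3 → ℂ)) (hS : ∀ s ∈ S, s ≠ 0) :
    ∃ x ≠ 0, eval x P = 0 ∧ ∀ s ∈ S, ∀ a : ℂ, (fun i => eval x (φ.lift i)) ≠ a • s := by
  by_contra! hcon
  have hlift0 : ∀ i, eval 0 (φ.lift i) = 0 := fun i => (φ.homogeneous i).eval_zero_of_ne_zero hD
  have hchoose : ∀ s ∈ S, ∃ ij : Fin 3 × Fin 3,
      ¬ P ∣ C (s ij.1) * φ.lift ij.2 - C (s ij.2) * φ.lift ij.1 := by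
    intro s hs
    by_contra! hdvd
    obtain ⟨i, hi⟩ := Function.ne_iff.1 (hS s hs)
    -- At a common zero of `P` and `φ.lift i` with `s i ≠ 0`, divisibility of the minors forces all
    -- the other components to vanish too.
    obtain ⟨x, hx, hxP, hxi⟩ := exists_common_zero hP0 (hlift0 i)
    refine φ.no_common_zero x hx (_root_.funext fun j => ?_)
    obtain ⟨g, hg⟩ := hdvd (i, j)
    have := congrArg (eval x) hg
    simp only [map_sub, map_mul, eval_C, hxi, hxP, mul_zero, sub_zero, zero_mul] at this
    exact (mul_eq_zero.1 this).resolve_left hi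
  choose! ij hij using hchoose
  have hdvd : P ∣ ∏ s ∈ S, (C (s (ij s).1) * φ.lift (ij s).2 - C (s (ij s).2) * φ.lift (ij s).1) := by
    refine dvd_of_forall_eval_eq_zero hP fun x hx => ?_
    rw [map_prod, Finset.prod_eq_zero_iff]
    by_cases hx0 : x = 0
    -- At the origin every factor vanishes, but the product needs at least one factor. A nonzero
    -- zero of `P` shows that `S` is nonempty.
    · obtain ⟨y, hy, hyP, -⟩ := exists_common_zero hP0 hP0
      obtain ⟨s, hs, -⟩ := hcon y hy hyP
      exact ⟨s, hs, by rw [hx0, map_sub, map_mul, map_mul, hlift0, hlift0]; ring⟩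
    · obtain ⟨s, hs, a, ha⟩ := hcon x hx0 hx
      refine ⟨s, hs, ?_⟩
      have h : ∀ i, eval x (φ.lift i) = a * s i := fun i => congrFun ha i
      simp only [map_sub, map_mul, eval_C, h]
      ring
  obtain ⟨s, hs, hsd⟩ := hP.exists_mem_finset_dvd hdvd
  exact hij s hs hsd

/-- The form of a web does not vanish identically along the image of a curve. -/
theorem Web.exists_val_ne_zero_of_prime {k : ℕ} (W : Web k) (φ : P2Endo) (hD : φ.degree ≠ 0)
    {P : MvPolynomial (Fin 3) ℂ} (hP : Prime P) (hP0 : eval 0 P = 0) :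
    ∃ x v, eval x P = 0 ∧ W.form.val (fun i => eval x (φ.lift i)) v ≠ 0 := by
  classical
  obtain ⟨x, hx, hxP, hxS⟩ := φ.exists_eval_ne_smul hD hP hP0
    (W.finite_zeros.toFinset.image Projectivization.rep) (by
      intro s hs
      obtain ⟨p, -, rfl⟩ := Finset.mem_image.1 hs
      exact p.rep_nonzero)
  refine ⟨x, ?_⟩
  by_contra! hcon
  let p : P2 := Projectivization.mk ℂ _ (φ.no_common_zero x hx)
  obtain ⟨a, ha⟩ := Projectivization.exists_smul_eq_mk_rep ℂ _ (φ.no_common_zero x hx)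
  refine hxS p.rep (Finset.mem_image_of_mem _ (W.finite_zeros.mem_toFinset.2 fun v => ?_))
    (↑a⁻¹ : ℂ) ?_
  · rw [← ha]
    change W.form.val ((a : ℂ) • (fun i => eval x (φ.lift i))) v = 0
    rw [SymForm.val_smul_left W.isTwistedSection.coeff_homogeneous, hcon v hxP, mul_zero]
  · rw [← ha]
    change _ = (↑a⁻¹ : ℂ) • ((a : ℂ) • (fun i => eval x (φ.lift i)))
    rw [smul_smul]
    simp

/-! ### Zeros of binary forms -/

theorem MvPolynomial.IsHomogeneous.prime_of_degree_one {σ K : Type*} [Field K]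
    {L : MvPolynomial σ K} (h : L.IsHomogeneous 1) (h0 : L ≠ 0) : Prime L := by
  refine (irreducible_of_totalDegree_eq_one (h.totalDegree h0) fun x hx => ?_).prime
  refine isUnit_iff_ne_zero.2 fun hx0 => h0 ?_
  ext1 d
  simpa [hx0] using hx d

/-- The linear form in two variables with zero `q`. -/
def pointForm (q : Fin 2 → ℂ) : MvPolynomial (Fin 2) ℂ := C (q 1) * X 0 - C (q 0) * X 1

theorem eval_pointForm (q x : Fin 2 → ℂ) : eval x (pointForm q) = q 1 * x 0 - q 0 * x 1 := by
  simp [pointForm]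

theorem pointForm_isHomogeneous (q : Fin 2 → ℂ) : (pointForm q).IsHomogeneous 1 :=
  (isHomogeneous_C_mul_X _ _).sub (isHomogeneous_C_mul_X _ _)

theorem pointForm_ne_zero {q : Fin 2 → ℂ} (hq : q ≠ 0) : pointForm q ≠ 0 := by
  intro h
  apply hq
  have h0 := eval_pointForm q ![1, 0]
  have h1 := eval_pointForm q ![0, 1]
  rw [h] at h0 h1
  ext i
  fin_cases i
  · simpa using h1.symm
  · simpa using h0.symm

theorem pointForm_prime {q : Fin 2 → ℂ} (hq : q ≠ 0) : Prime (pointForm q) :=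
  (pointForm_isHomogeneous q).prime_of_degree_one (pointForm_ne_zero hq)

theorem exists_eq_smul_of_eval_pointForm {q x : Fin 2 → ℂ} (hq : q ≠ 0)
    (h : eval x (pointForm q) = 0) : ∃ t : ℂ, x = t • q := by
  rw [eval_pointForm] at h
  by_cases h0 : q 0 = 0
  · have h1 : q 1 ≠ 0 := by
      intro h1
      apply hq
      ext i
      fin_cases i
      · exact h0
      · exact h1
    refine ⟨x 1 / q 1, ?_⟩
    ext i
    fin_cases i
    · simpa [h0, h1] using h
    · simp [h1]
  · refine ⟨x 0 / q 0, ?_⟩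
    ext i
    fin_cases i
    · simp [h0]
    · simp only [Fin.mk_one, Pi.smul_apply, smul_eq_mul]
      field_simp
      linear_combination -h

theorem pointForm_dvd {q : Fin 2 → ℂ} (hq : q ≠ 0) {c : MvPolynomial (Fin 2) ℂ} {n : ℕ}
    (hc : c.IsHomogeneous n) (h : eval q c = 0) : pointForm q ∣ c := by
  refine dvd_of_forall_eval_eq_zero (pointForm_prime hq) fun x hx => ?_
  obtain ⟨t, rfl⟩ := exists_eq_smul_of_eval_pointForm hq hx
  rw [hc.eval_smul, h, mul_zero]

/-- A nonconstant binary form has a nontrivial zero. -/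
theorem exists_zero_of_binary_form {c : MvPolynomial (Fin 2) ℂ} {n : ℕ} (hn : n ≠ 0)
    (hc : c.IsHomogeneous n) : ∃ q ≠ 0, eval q c = 0 := by
  by_contra! hcon
  -- Without a nontrivial zero, `c` divides powers of both coordinates. These are relatively prime,
  -- so `c` is a unit, although it vanishes at the origin.
  have hdvd : ∀ i : Fin 2, ∃ m : ℕ, c ∣ (X i : MvPolynomial (Fin 2) ℂ) ^ m := by
    intro i
    obtain ⟨m, hm⟩ := exists_pow_mem_span_of_zeroLocus (S := {c}) (f := X i) (by
      intro x hx
      by_cases hx0 : x = 0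
      · simp [hx0]
      · exact absurd (hx c rfl) (hcon x hx0))
    exact ⟨m, Ideal.mem_span_singleton.1 hm⟩
  obtain ⟨m, hm⟩ := hdvd 0
  obtain ⟨l, hl⟩ := hdvd 1
  have hrel : IsRelPrime ((X 0 : MvPolynomial (Fin 2) ℂ) ^ m) (X 1 ^ l) := by
    refine IsRelPrime.pow ((MvPolynomial.X_prime (i := 0)).irreducible.isRelPrime_iff_not_dvd.2 fun h => ?_)
    exact absurd (X_dvd_X.1 h) (by decide)
  have hu := hrel hm hl
  have h0 : eval 0 c ≠ 0 := (hu.map (eval 0)).ne_zero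
  exact h0 (hc.eval_zero_of_ne_zero hn)

/-- A binary form of degree `n` has `n` zeros on the projective line, with multiplicity. -/
theorem hasSum_emultiplicity_pointForm {c : MvPolynomial (Fin 2) ℂ} {n : ℕ}
    (hc : c.IsHomogeneous n) (h0 : c ≠ 0) :
    HasSum (fun q : P1 => emultiplicity (pointForm q.rep) c) (n : ℕ∞) := by
  classical
  induction n generalizing c with
  | zero =>
    have hu : IsUnit c := by
      rw [(totalDegree_eq_zero_iff_eq_C (p := c)).1 ((totalDegree_zero_iff_isHomogeneous _).2 hc)] at h0 ⊢
      exact (isUnit_iff_ne_zero.2 fun h => h0 (by rw [h, C_0])).map C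
    have : (fun q : P1 => emultiplicity (pointForm q.rep) c) = fun _ => 0 := by
      ext1 q
      exact emultiplicity_of_isUnit_right (pointForm_prime q.rep_nonzero).not_isUnit hu
    rw [this]
    simp
  | succ n ih =>
    obtain ⟨q, hq, hqc⟩ := exists_zero_of_binary_form n.succ_ne_zero hc
    let p : P1 := Projectivization.mk ℂ q hq
    obtain ⟨a, ha⟩ := Projectivization.exists_smul_eq_mk_rep ℂ q hq
    have hpc : eval p.rep c = 0 := by
      rw [← ha]
      change eval ((a : ℂ) • q) c = 0
      rw [hc.eval_smul, hqc, mul_zero]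
    obtain ⟨c', rfl⟩ := pointForm_dvd p.rep_nonzero hc hpc
    obtain ⟨i, j, hi, hj, hij⟩ := hc.exists_of_mul h0
    have hi1 := hi.inj_right (pointForm_isHomogeneous _) (left_ne_zero_of_mul h0)
    obtain rfl : j = n := by omega
    have hsum := (hasSum_ite_eq p (1 : ℕ∞)).add (ih hj (right_ne_zero_of_mul h0))
    rw [Nat.cast_succ, add_comm]
    convert hsum using 2 with r
    rw [emultiplicity_mul (pointForm_prime r.rep_nonzero)]
    congr 1
    split_ifs with hr
    · rw [hr]
      simpa using emultiplicity_pow_self_of_prime (pointForm_prime p.rep_nonzero) 1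
    · refine emultiplicity_eq_zero.2 fun hdvd => hr ?_
      obtain ⟨g, hg⟩ := hdvd
      have h1 := congrArg (eval r.rep) hg
      have h2 : eval r.rep (pointForm r.rep) = 0 := by rw [eval_pointForm]; ring
      rw [map_mul, h2, zero_mul] at h1
      obtain ⟨t, ht⟩ := exists_eq_smul_of_eval_pointForm p.rep_nonzero h1
      rw [← r.mk_rep, ← p.mk_rep, Projectivization.mk_eq_mk_iff']
      exact ⟨t, ht.symm⟩

/-! ### Restriction to lines and the degree of a web -/

theorem MvPolynomial.emultiplicity_C_C {σ R : Type*} [CommRing R] (p q : R) :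
    emultiplicity (C p : MvPolynomial σ R) (C q) = emultiplicity p q := by
  rw [emultiplicity_eq_emultiplicity_iff]
  intro n
  rw [← map_pow, C_dvd_iff_dvd_coeff]
  refine ⟨fun h => by simpa using h 0, fun h i => ?_⟩
  classical
  rw [coeff_C]
  split_ifs
  · exact h
  · exact dvd_zero _

/-- The form `s dt - t ds` on the plane with coordinates `s, t`. -/
def contactForm : SymForm 2 := C (X 0) * X 1 - C (X 1) * X 0

theorem val_contactForm (x v : Fin 2 → ℂ) : contactForm.val x v = x 0 * v 1 - x 1 * v 0 := by
  rw [← SymForm.valHom_apply, contactForm, map_sub, map_mul, map_mul]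
  simp only [SymForm.valHom_C, SymForm.valHom_X, eval_X]

/-- At `q ≠ 0` the contact form is a nonzero linear form in `v`. Thus its powers contribute nothing
to the tangencies. -/
theorem not_C_dvd_contactForm {L : MvPolynomial (Fin 2) ℂ} {q : Fin 2 → ℂ} (hq : q ≠ 0)
    (h : eval q L = 0) : ¬ C L ∣ contactForm := by
  rintro ⟨g, hg⟩
  have hval : ∀ v : Fin 2 → ℂ, q 0 * v 1 - q 1 * v 0 = 0 := fun v => by
    rw [← val_contactForm, hg, SymForm.val_C_mul, h, zero_mul]
  apply hq
  ext i
  fin_cases i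
  · simpa using hval ![0, 1]
  · simpa using hval ![1, 0]

namespace Web

variable {k : ℕ} (W : Web k)

theorem val_restrictLine (A : Matrix (Fin 3) (Fin 2) ℂ) (x v : Fin 2 → ℂ) :
    (W.restrictLine A).val x v = W.form.val (A.mulVec x) (A.mulVec v) := by
  rw [restrictLine, SymForm.val_pullback]
  congr 1
  · ext i
    simp [Matrix.mulVec, dotProduct]
  · ext i
    simp [Matrix.mulVec, dotProduct, pderiv_X, Pi.single_apply]

/-- The restriction of the defining form to a line is a multiple of `(s dt - t ds) ^ k`. -/
theorem exists_restrictLine_eq (A : Matrix (Fin 3) (Fin 2) ℂ) (h0 : W.restrictLine A ≠ 0) :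
    ∃ (m : ℕ) (c : MvPolynomial (Fin 2) ℂ), c.IsHomogeneous m ∧ c ≠ 0 ∧ m + k = W.coeffDegree ∧
      W.restrictLine A = C c * contactForm ^ k := by
  let F : Fin 3 → MvPolynomial (Fin 2) ℂ := fun i => ∑ j, C (A i j) * X j
  -- The value of the restricted form on the constant vector `(0, 1)`, where the contact form equals
  -- `s`. It will be `s ^ k * c`.
  let a : MvPolynomial (Fin 2) ℂ := W.form.subst F fun i => C (A i 1)
  have ha : a.IsHomogeneous W.coeffDegree := by
    have := SymForm.subst_isHomogeneous (p := 1) (q := 0) W.isTwistedSection.homogeneous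
      W.isTwistedSection.coeff_homogeneous (F := F) (G := fun i => C (A i 1))
      (fun i => IsHomogeneous.sum _ _ _ fun j _ => isHomogeneous_C_mul_X _ _)
      (fun i => isHomogeneous_C _ _)
    simpa using this
  have key : C (X 0 ^ k) * W.restrictLine A = contactForm ^ k * C a := by
    refine SymForm.ext_val fun x v => ?_
    -- Modulo the radial vector `x`, the vector `x 0 • v` is the contact value times `(0, 1)`.
    have hv : x 0 • v = (x 0 * v 1 - x 1 * v 0) • ![0, 1] + v 0 • x := by
      ext i
      fin_cases i
      · simp; ring
      · simp; ring
    rw [SymForm.val_C_mul, mul_comm (contactForm ^ k), SymForm.val_C_mul, map_pow, eval_X,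
      val_restrictLine, ← SymForm.val_smul_right W.isTwistedSection.homogeneous,
      ← Matrix.mulVec_smul, hv, Matrix.mulVec_add, Matrix.mulVec_smul A (v 0),
      SymForm.val_add_smul_of_contractRadial W.isTwistedSection.radial, Matrix.mulVec_smul,
      SymForm.val_smul_right W.isTwistedSection.homogeneous, ← val_contactForm,
      ← SymForm.valHom_apply _ _ (contactForm ^ k), map_pow, SymForm.valHom_apply,
      SymForm.eval_subst, mul_comm]
    congr 2
    · ext i
      simp [F, Matrix.mulVec, dotProduct]
    · ext i
      simp [Matrix.mulVec, dotProduct]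
  have hX : Prime (C (X 0) : SymForm 2) := (prime_C_iff _).2 (MvPolynomial.X_prime (i := 0))
  have hdvd : C (X 0 ^ k) ∣ (C a : SymForm 2) := by
    rw [map_pow]
    refine hX.pow_dvd_of_dvd_mul_left k (fun h => ?_) ⟨W.restrictLine A, by rw [← map_pow, key]⟩
    exact not_C_dvd_contactForm (q := ![0, 1]) (by simp) (by simp) (hX.dvd_of_dvd_pow h)
  obtain ⟨c, hc⟩ : X 0 ^ k ∣ a := by simpa using (C_dvd_iff_dvd_coeff _ _).1 hdvd 0
  have hXk : (C (X 0 ^ k) : SymForm 2) ≠ 0 := by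
    rw [map_pow]
    exact pow_ne_zero _ hX.ne_zero
  have heq : W.restrictLine A = C c * contactForm ^ k := by
    apply mul_left_cancel₀ hXk
    rw [key, hc, map_mul]
    ring
  have hc0 : c ≠ 0 := by
    rintro rfl
    exact h0 (by rw [heq, map_zero, zero_mul])
  have hne : X 0 ^ k * c ≠ 0 := mul_ne_zero (pow_ne_zero _ (X_ne_zero 0)) hc0
  rw [hc] at ha
  obtain ⟨i, m, hi, hm, him⟩ := ha.exists_of_mul hne
  have hik := hi.inj_right (isHomogeneous_X_pow 0 k) (left_ne_zero_of_mul hne)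
  exact ⟨m, c, hm, hc0, by omega, heq⟩

theorem tangencies_add (A : Matrix (Fin 3) (Fin 2) ℂ) (h0 : W.restrictLine A ≠ 0) :
    ∃ m : ℕ, m + k = W.coeffDegree ∧ W.tangencies A = m := by
  obtain ⟨m, c, hc, hc0, hm, h⟩ := W.exists_restrictLine_eq A h0
  refine ⟨m, hm, ?_⟩
  rw [← (hasSum_emultiplicity_pointForm hc hc0).tsum_eq, tangencies]
  congr 1
  ext1 q
  have hL := pointForm_prime q.rep_nonzero
  have hCL : Prime (C (pointForm q.rep) : SymForm 2) := (prime_C_iff _).2 hL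
  change emultiplicity (C (pointForm q.rep)) _ = _
  rw [h, emultiplicity_mul hCL, emultiplicity_C_C, emultiplicity_pow hCL,
    emultiplicity_eq_zero.2 (not_C_dvd_contactForm q.rep_nonzero (by rw [eval_pointForm]; ring)),
    mul_zero, add_zero]

/-- The identity of the projective plane. -/
def _root_.P2Endo.id : P2Endo where
  degree := 1
  lift := X
  homogeneous := isHomogeneous_X ℂ
  no_common_zero x hx := by simpa using hx

theorem exists_val_ne_zero : ∃ x v, W.form.val x v ≠ 0 := by
  obtain ⟨x, v, -, h⟩ := W.exists_val_ne_zero_of_prime P2Endo.id one_ne_zero (MvPolynomial.X_prime (i := 0)) (by simp)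
  exact ⟨_, v, h⟩

/-- The degree of a web is well defined, and determined by the degree of its coefficients. -/
theorem exists_hasDegree_iff : ∃ d : ℕ, d + k = W.coeffDegree ∧ ∀ n, W.HasDegree n ↔ n = d := by
  -- `Q` evaluates the form at the first column of `A` on the second. If it is nonzero, the
  -- restriction to the line is not identically zero.
  let Q : MvPolynomial (Fin 3 × Fin 2) ℂ := W.form.subst (fun i => X (i, 0)) fun i => X (i, 1)
  have hQ : Q ≠ 0 := by
    obtain ⟨x, v, h⟩ := W.exists_val_ne_zero
    intro h0
    have := W.form.eval_subst (fun i => X (i, 0)) (fun i => X (i, 1))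
      (fun ij : Fin 3 × Fin 2 => if ij.2 = 0 then x ij.1 else v ij.1)
    rw [show SymForm.subst _ _ _ = 0 from h0] at this
    simp only [eval_X, map_zero, if_true, Fin.isValue, one_ne_zero, if_false] at this
    exact h this.symm
  have hA : ∀ A : Matrix (Fin 3) (Fin 2) ℂ, eval (fun ij => A ij.1 ij.2) Q ≠ 0 →
      W.restrictLine A ≠ 0 := by
    intro A hA h0
    apply hA
    have h := W.val_restrictLine A ![1, 0] ![0, 1]
    rw [h0, ← SymForm.valHom_apply, map_zero] at h
    rw [SymForm.eval_subst, h]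
    congr 1
    · ext i; simp [Matrix.mulVec, dotProduct]
    · ext i; simp [Matrix.mulVec, dotProduct]
  let M : MvPolynomial (Fin 3 × Fin 2) ℂ := X (0, 0) * X (1, 1) - X (0, 1) * X (1, 0)
  have hM : M ≠ 0 := by
    intro h0
    have := congrArg (eval fun ij : Fin 3 × Fin 2 => if ij.1.val = ij.2.val then (1 : ℂ) else 0) h0
    simp [M] at this
  have hinj : ∀ A : Matrix (Fin 3) (Fin 2) ℂ, eval (fun ij => A ij.1 ij.2) M ≠ 0 →
      Function.Injective A.mulVec := by
    intro A hA x y hxy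
    have h0 := congrFun hxy 0
    have h1 := congrFun hxy 1
    simp only [Matrix.mulVec, dotProduct, Fin.sum_univ_two] at h0 h1
    simp only [M, map_sub, map_mul, eval_X] at hA
    ext i
    apply mul_left_cancel₀ hA
    fin_cases i
    · simp only [Fin.zero_eta]
      linear_combination A 1 1 * h0 - A 0 1 * h1
    · simp only [Fin.mk_one]
      linear_combination A 0 0 * h1 - A 1 0 * h0
  have hexists : ∀ R : MvPolynomial (Fin 3 × Fin 2) ℂ, R ≠ 0 → ∃ A : Matrix (Fin 3) (Fin 2) ℂ,
      eval (fun ij => A ij.1 ij.2) R ≠ 0 := by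
    intro R hR
    by_contra! hcon
    exact hR (MvPolynomial.funext fun x => by simpa using hcon (Matrix.of fun i j => x (i, j)))
  obtain ⟨A₀, hA₀⟩ := hexists Q hQ
  obtain ⟨d, hd, -⟩ := W.tangencies_add A₀ (hA A₀ hA₀)
  have htan : ∀ A : Matrix (Fin 3) (Fin 2) ℂ, eval (fun ij => A ij.1 ij.2) Q ≠ 0 →
      W.tangencies A = d := by
    intro A h
    obtain ⟨m, hm, hmA⟩ := W.tangencies_add A (hA A h)
    rw [hmA, show m = d by omega]
  refine ⟨d, hd, fun n => ⟨?_, ?_⟩⟩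
  · rintro ⟨R, hR, h⟩
    -- Two generic conditions and injectivity, given by the minor `M`, hold for a common `A`, so the
    -- two counts coincide.
    obtain ⟨A, hAne⟩ := hexists (Q * M * R) (mul_ne_zero (mul_ne_zero hQ hM) hR)
    rw [map_mul, map_mul] at hAne
    have h1 := h A (hinj A (right_ne_zero_of_mul (left_ne_zero_of_mul hAne)))
      (right_ne_zero_of_mul hAne)
    rw [htan A (left_ne_zero_of_mul (left_ne_zero_of_mul hAne))] at h1
    exact_mod_cast h1.symm
  · rintro rfl
    exact ⟨Q, hQ, fun A _ h => htan A h⟩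

end Web

/-! ### Divisibility, adjugates and products of linear forms -/

/-- Each prime factor of `h` misses some `a i`, hence divides `g`. It is cancelled from both sides
and the argument repeated. -/
theorem UniqueFactorizationMonoid.dvd_of_forall_dvd_mul {R ι : Type*} [CommMonoidWithZero R]
    [UniqueFactorizationMonoid R] (a : ι → R) {h g : R} (h0 : h ≠ 0)
    (hp : ∀ p, Prime p → p ∣ h → ∃ i, ¬ p ∣ a i) (hd : ∀ i, h ∣ g * a i) : h ∣ g := by
  induction h using UniqueFactorizationMonoid.induction_on_prime generalizing g with
  | h₁ => exact absurd rfl h0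
  | h₂ x hx => exact hx.dvd
  | h₃ b p hb hpp ih =>
    obtain ⟨i, hi⟩ := hp p hpp (dvd_mul_right p b)
    obtain ⟨g', rfl⟩ := (hpp.dvd_or_dvd ((dvd_mul_right p b).trans (hd i))).resolve_right hi
    refine mul_dvd_mul_left p (ih hb (fun q hq hqb => hp q hq (hqb.mul_left p)) fun j => ?_)
    have := hd j
    rw [mul_assoc] at this
    exact (mul_dvd_mul_iff_left hpp.ne_zero).1 this

namespace Matrix

theorem mul_eq_mul_of_adjugate_eq_zero {R : Type*} [CommRing R] {B : Matrix (Fin 3) (Fin 3) R}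
    (h : B.adjugate = 0) (i i' j j' : Fin 3) : B i j * B i' j' = B i j' * B i' j := by
  rw [adjugate_fin_three] at h
  have e : ∀ a b, _ = (0 : Matrix (Fin 3) (Fin 3) R) a b := fun a b => congrFun (congrFun h a) b
  have h00 := e 0 0
  have h01 := e 0 1
  have h02 := e 0 2
  have h10 := e 1 0
  have h11 := e 1 1
  have h12 := e 1 2
  have h20 := e 2 0
  have h21 := e 2 1
  have h22 := e 2 2
  simp at h00 h01 h02 h10 h11 h12 h20 h21 h22
  clear e h
  rcases eq_or_ne i i' with rfl | hi
  · exact mul_comm _ _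
  rcases eq_or_ne j j' with rfl | hj
  · rfl
  fin_cases i <;> fin_cases i' <;> first | exact absurd rfl hi | skip
  all_goals (fin_cases j <;> fin_cases j' <;> simp only [Fin.zero_eta, Fin.mk_one, Fin.reduceFinMk, Fin.isValue] <;>
    first | exact absurd rfl hj | grind)

/-- The adjugate of a singular matrix of size three has rank at most one. -/
theorem exists_adjugate_mulVec_eq_smul {K : Type*} [Field K] {A : Matrix (Fin 3) (Fin 3) K}
    (h : A.det = 0) : ∃ (l : (Fin 3 → K) →ₗ[K] K) (w : Fin 3 → K), ∀ u,
      A.adjugate.mulVec u = l u • w := by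
  -- In size three, `adj (adj A) = det A • A`, so all the 2×2 minors of `adj A` vanish.
  have hadj : A.adjugate.adjugate = 0 := by
    rw [adjugate_adjugate _ (by simp), h]
    simp
  by_cases h0 : A.adjugate = 0
  · exact ⟨0, 0, fun u => by simp [h0]⟩
  · obtain ⟨i₀, j₀, hij⟩ : ∃ i j, A.adjugate i j ≠ 0 := by
      by_contra! hcon
      exact h0 (Matrix.ext hcon)
    refine ⟨(A.adjugate i₀ j₀)⁻¹ • (LinearMap.proj i₀ ∘ₗ A.adjugate.mulVecLin),
      fun i => A.adjugate i j₀, fun u => ?_⟩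
    ext i
    simp only [LinearMap.smul_apply, LinearMap.comp_apply, mulVecLin_apply, LinearMap.proj_apply,
      Pi.smul_apply, smul_eq_mul, mulVec, dotProduct, Finset.mul_sum, Finset.sum_mul]
    refine Finset.sum_congr rfl fun j _ => ?_
    have := mul_eq_mul_of_adjugate_eq_zero hadj i i₀ j j₀
    field_simp
    linear_combination u j * this

theorem det_isHomogeneous {σ R n : Type*} [CommRing R] [Fintype n] [DecidableEq n]
    {M : Matrix n n (MvPolynomial σ R)} {d : ℕ} (h : ∀ i j, (M i j).IsHomogeneous d) :
    M.det.IsHomogeneous (Fintype.card n * d) := by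
  rw [det_apply]
  refine IsHomogeneous.sum _ _ _ fun s _ => ?_
  have : (∏ i, M (s i) i).IsHomogeneous (Fintype.card n * d) := by
    simpa using IsHomogeneous.prod Finset.univ (fun i => M (s i) i) (fun _ => d) fun i _ => h _ _
  rcases Int.units_eq_one_or s.sign with hs | hs
  · simpa [hs] using this
  · simpa [hs] using this.neg

end Matrix

/-- Two linear forms whose product with further forms is a nonzero multiple of the power of a linear
form are proportional. -/
theorem LinearMap.not_linearIndependent_of_prod_eq_pow {k : ℕ} {K V : Type*} [Field K] [Infinite K]
    [AddCommGroup V] [Module K V] {l : Fin k → V →ₗ[K] K} (hl : ∀ i, l i ≠ 0) {m : V →ₗ[K] K} {c : K}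
    (h : ∀ u, ∏ i, l i u = c * m u ^ k) (i j : Fin k) : ¬ LinearIndependent K ![l i, l j] := by
  have hk : k ≠ 0 := by
    rintro rfl
    exact i.elim0
  -- Over an infinite field some `u` avoids the kernels of all `l i`, which makes `c` and `m u`
  -- nonzero. Then the kernel of each `l i` lies in that of `m`, so every `l i` is proportional to
  -- `m`.
  obtain ⟨u, hu⟩ := Module.Dual.exists_forall_ne_zero_of_forall_exists l fun i => by
    by_contra! hcon
    exact hl i (LinearMap.ext hcon)
  have hu0 : c * m u ^ k ≠ 0 := by
    rw [← h]
    exact Finset.prod_ne_zero_iff.2 fun i _ => hu i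
  have hmu : m u ≠ 0 := fun h => right_ne_zero_of_mul hu0 (by rw [h, zero_pow hk])
  have hker : ∀ i v, l i v = 0 → m v = 0 := by
    intro i v hv
    have := h v
    rw [Finset.prod_eq_zero (Finset.mem_univ i) hv, eq_comm, mul_eq_zero] at this
    exact eq_zero_of_pow_eq_zero (this.resolve_left (left_ne_zero_of_mul hu0))
  have hprop : ∀ i v, m v = m u / l i u * l i v := by
    intro i v
    have := hker i (v - (l i v / l i u) • u) (by simp [hu i])
    simp only [map_sub, map_smul, smul_eq_mul] at this
    rw [sub_eq_zero.1 this]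
    ring
  intro hind
  have := LinearIndependent.pair_iff.1 hind (m u / l i u) (-(m u / l j u)) (by
    ext v
    simp only [LinearMap.add_apply, LinearMap.smul_apply, smul_eq_mul, neg_mul, LinearMap.zero_apply]
    rw [← hprop, ← hprop]
    ring)
  exact div_ne_zero hmu (hu i) this.1

/-! ### Endomorphisms leaving a web invariant -/

namespace P2Endo

variable {k : ℕ} (φ : P2Endo) (W : Web k)

/-- The endomorphism of the plane induced by an invertible matrix. -/
def ofMatrix (M : Matrix (Fin 3) (Fin 3) ℂ) (hM : IsUnit M.det) : P2Endo where
  degree := 1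
  lift i := ∑ j, C (M i j) * X j
  homogeneous i := IsHomogeneous.sum _ _ _ fun j _ => isHomogeneous_C_mul_X _ _
  no_common_zero x hx h := by
    have h1 : M.mulVec x = 0 := by
      rw [← h]
      ext i
      simp [Matrix.mulVec, dotProduct]
    apply hx
    rw [← Matrix.one_mulVec x, ← Matrix.nonsing_inv_mul M hM, ← Matrix.mulVec_mulVec, h1,
      Matrix.mulVec_zero]

theorem toFun_eq_mk {ψ : P2Endo} {M : Matrix (Fin 3) (Fin 3) ℂ}
    (hψ : ∀ x, (fun i => eval x (ψ.lift i)) = M.mulVec x) (x : Fin 3 → ℂ) (hx : x ≠ 0) :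
    ψ.toFun (Projectivization.mk ℂ x hx) = Projectivization.mk ℂ (M.mulVec x)
      (hψ x ▸ ψ.no_common_zero x hx) := by
  obtain ⟨a, ha⟩ := Projectivization.exists_smul_eq_mk_rep ℂ x hx
  rw [toFun, Projectivization.mk_eq_mk_iff]
  refine ⟨a, ?_⟩
  rw [hψ, ← ha]
  exact (Matrix.mulVec_smul M (a : ℂ) x).symm

theorem isInvertible_of_degree_eq_one (h : φ.degree = 1) : φ.IsInvertible := by
  have hlin : ∀ i, ∃ c : Fin 3 → ℂ, ∑ j, c j • X j = φ.lift i := by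
    intro i
    have := φ.homogeneous i
    rw [h, ← mem_homogeneousSubmodule, homogeneousSubmodule_one_eq_span_X] at this
    exact (Submodule.mem_span_range_iff_exists_fun ℂ).1 this
  choose c hc using hlin
  let M : Matrix (Fin 3) (Fin 3) ℂ := Matrix.of c
  have hφ : ∀ x, (fun i => eval x (φ.lift i)) = M.mulVec x := by
    intro x
    ext i
    simp [← hc, M, Matrix.mulVec, dotProduct, smul_eval]
  have hM : IsUnit M.det := by
    rw [isUnit_iff_ne_zero]
    intro h0
    obtain ⟨v, hv, hMv⟩ := Matrix.exists_mulVec_eq_zero_iff.2 h0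
    exact φ.no_common_zero v hv (by rw [hφ, hMv])
  have hM' : IsUnit M⁻¹.det := Matrix.isUnit_nonsing_inv_det M hM
  have hψ : ∀ x, (fun i => eval x ((ofMatrix M⁻¹ hM').lift i)) = M⁻¹.mulVec x := by
    intro x
    ext i
    simp [ofMatrix, Matrix.mulVec, dotProduct]
  refine ⟨ofMatrix M⁻¹ hM', fun p => ?_, fun p => ?_⟩
  · rw [← p.mk_rep, toFun_eq_mk hφ, toFun_eq_mk hψ]
    congr 1
    rw [Matrix.mulVec_mulVec, Matrix.nonsing_inv_mul M hM, Matrix.one_mulVec]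
  · rw [← p.mk_rep, toFun_eq_mk hψ, toFun_eq_mk hφ]
    congr 1
    rw [Matrix.mulVec_mulVec, Matrix.mul_nonsing_inv M hM, Matrix.one_mulVec]

/-- A constant lift has zero differential and so, as `k ≥ 1`, pulls the form back to zero, whereas
`h ω ≠ 0`. -/
theorem degree_ne_zero_of_leavesInvariant (hk : 1 ≤ k) (hW : φ.LeavesInvariant W) :
    φ.degree ≠ 0 := by
  intro h0
  obtain ⟨h, hh, heq⟩ := hW
  obtain ⟨x, v, hxv⟩ := W.exists_val_ne_zero
  have hform : W.form ≠ 0 := by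
    intro h
    rw [h, ← SymForm.valHom_apply, map_zero] at hxv
    exact hxv rfl
  refine mul_ne_zero ((C_ne_zero (σ := Fin 3)).2 hh) hform ?_
  rw [← heq]
  refine SymForm.ext_val fun x v => ?_
  rw [pullbackForm, SymForm.val_pullback]
  have hd : ∀ i j, pderiv j (φ.lift i) = 0 := by
    intro i j
    have := φ.homogeneous i
    rw [h0, ← totalDegree_zero_iff_isHomogeneous, totalDegree_eq_zero_iff_eq_C] at this
    rw [this, pderiv_C]
  have : (fun i => ∑ j, eval x (pderiv j (φ.lift i)) * v j) = (0 : ℂ) • (0 : Fin 3 → ℂ) := by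
    ext i
    simp [hd]
  rw [this, SymForm.val_smul_right W.isTwistedSection.homogeneous, zero_pow (by omega), zero_mul,
    ← SymForm.valHom_apply, map_zero]

/-- The Jacobian matrix of the homogeneous lift. -/
def jacobianMatrix : Matrix (Fin 3) (Fin 3) (MvPolynomial (Fin 3) ℂ) :=
  Matrix.of fun i j => pderiv j (φ.lift i)

theorem det_jacobianMatrix : φ.jacobianMatrix.det = φ.jacobian := rfl

theorem jacobian_isHomogeneous : φ.jacobian.IsHomogeneous (3 * (φ.degree - 1)) := by
  rw [← det_jacobianMatrix]
  simpa using Matrix.det_isHomogeneous (M := φ.jacobianMatrix) fun i j => (φ.homogeneous i).pderiv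

theorem jacobian_ne_zero (hD : φ.degree ≠ 0) : φ.jacobian ≠ 0 :=
  det_pderiv_ne_zero_of_no_common_zero hD φ.homogeneous φ.no_common_zero

variable {φ W} {h : MvPolynomial (Fin 3) ℂ}

theorem val_of_pullbackForm_eq (heq : φ.pullbackForm W = C h * W.form) (x v : Fin 3 → ℂ) :
    W.form.val (fun i => eval x (φ.lift i)) ((φ.jacobianMatrix.map (eval x)).mulVec v) =
      eval x h * W.form.val x v := by
  rw [← SymForm.val_C_mul, ← heq, pullbackForm, SymForm.val_pullback]
  rfl

/-- The invariance identity applied to `v = adj(DΦ) u`, using `DΦ adj(DΦ) = J`. -/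
theorem jacobian_pow_mul_val (heq : φ.pullbackForm W = C h * W.form) (x u : Fin 3 → ℂ) :
    eval x φ.jacobian ^ k * W.form.val (fun i => eval x (φ.lift i)) u =
      eval x h * W.form.val x ((φ.jacobianMatrix.map (eval x)).adjugate.mulVec u) := by
  rw [← val_of_pullbackForm_eq heq, Matrix.mulVec_mulVec, Matrix.mul_adjugate, Matrix.smul_mulVec,
    Matrix.one_mulVec, SymForm.val_smul_right W.isTwistedSection.homogeneous, ← det_jacobianMatrix,
    RingHom.map_det]
  rfl

/-- The equation of the divisor of zeros of `φ^* ω` is homogeneous, of the expected degree. -/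
theorem exists_isHomogeneous_of_pullbackForm_eq (h0 : h ≠ 0)
    (heq : φ.pullbackForm W = C h * W.form) :
    ∃ m, h.IsHomogeneous m ∧
      m + W.coeffDegree = φ.degree * W.coeffDegree + (φ.degree - 1) * k := by
  obtain ⟨x, v, hxv⟩ := W.exists_val_ne_zero
  let f : MvPolynomial (Fin 3) ℂ := W.form.subst X fun i => C (v i)
  have hf : f.IsHomogeneous W.coeffDegree := by
    simpa using SymForm.subst_isHomogeneous (p := 1) (q := 0) W.isTwistedSection.homogeneous
      W.isTwistedSection.coeff_homogeneous (isHomogeneous_X ℂ) (fun i : Fin 3 => isHomogeneous_C _ (v i))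
  have hf0 : f ≠ 0 := by
    intro hf
    have := W.form.eval_subst X (fun i => C (v i)) x
    rw [show SymForm.subst _ _ _ = 0 from hf] at this
    simp only [eval_X, map_zero, eval_C] at this
    exact hxv this.symm
  -- For a fixed `v` with `f ≠ 0`, the product `h * f` is visibly homogeneous, so its factor `h` is
  -- too, with the degree given by subtraction.
  have hhf : h * f = W.form.subst φ.lift fun i => ∑ j, pderiv j (φ.lift i) * C (v j) := by
    refine MvPolynomial.funext fun y => ?_
    rw [map_mul, SymForm.eval_subst, SymForm.eval_subst]
    simp only [eval_X, eval_C, map_sum, map_mul]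
    exact (val_of_pullbackForm_eq heq y v).symm
  have hhom : (h * f).IsHomogeneous (φ.degree * W.coeffDegree + (φ.degree - 1) * k) := by
    rw [hhf]
    refine SymForm.subst_isHomogeneous W.isTwistedSection.homogeneous
      W.isTwistedSection.coeff_homogeneous φ.homogeneous fun i => ?_
    exact IsHomogeneous.sum _ _ _ fun j _ => by
      simpa using (φ.homogeneous i).pderiv.mul (isHomogeneous_C (Fin 3) (v j))
  obtain ⟨a, b, ha, hb, hab⟩ := hhom.exists_of_mul (mul_ne_zero h0 hf0)
  have := hb.inj_right hf hf0
  exact ⟨a, ha, by omega⟩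

/-- A prime factor of a form is a form of positive degree, since a constant one would be a unit. It
therefore passes through the origin, as the nonvanishing lemmas require. -/
theorem eval_zero_of_dvd {P f : MvPolynomial (Fin 3) ℂ} {m : ℕ} (hf : f.IsHomogeneous m)
    (hf0 : f ≠ 0) (hP : Prime P) (hd : P ∣ f) : ∃ r, P.IsHomogeneous r ∧ eval 0 P = 0 := by
  obtain ⟨g, rfl⟩ := hd
  obtain ⟨r, -, hr, -, -⟩ := hf.exists_of_mul hf0
  refine ⟨r, hr, hr.eval_zero_of_ne_zero ?_⟩
  rintro rfl
  rw [← totalDegree_zero_iff_isHomogeneous, totalDegree_eq_zero_iff_eq_C] at hr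
  have h0 := hP.ne_zero
  apply hP.not_isUnit
  rw [hr] at h0 ⊢
  exact (isUnit_iff_ne_zero.2 fun h => h0 (by rw [h, C_0])).map C

/-- The divisor of zeros of `φ^* ω` is bounded by `k Δ_φ`. -/
theorem dvd_jacobian_pow (hD : φ.degree ≠ 0) (h0 : h ≠ 0)
    (heq : φ.pullbackForm W = C h * W.form) : h ∣ φ.jacobian ^ k := by
  obtain ⟨m, hm, -⟩ := exists_isHomogeneous_of_pullbackForm_eq h0 heq
  refine UniqueFactorizationMonoid.dvd_of_forall_dvd_mul
    (fun u : Fin 3 → ℂ => W.form.subst φ.lift fun i => C (u i)) h0 (fun P hP hPh => ?_) fun u => ?_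
  · obtain ⟨-, -, hP0⟩ := eval_zero_of_dvd hm h0 hP hPh
    obtain ⟨x, u, hx, hxu⟩ := W.exists_val_ne_zero_of_prime φ hD hP hP0
    refine ⟨u, ?_⟩
    rintro ⟨g, hg⟩
    have := W.form.eval_subst φ.lift (fun i => C (u i)) x
    rw [hg, map_mul, hx, zero_mul] at this
    simp only [eval_C] at this
    exact hxu this.symm
  · refine ⟨W.form.subst X fun i => ∑ j, φ.jacobianMatrix.adjugate i j * C (u j), ?_⟩
    refine MvPolynomial.funext fun x => ?_
    rw [map_mul, map_mul, map_pow, SymForm.eval_subst, SymForm.eval_subst]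
    simp only [eval_C, eval_X, map_sum, map_mul]
    rw [jacobian_pow_mul_val heq]
    congr 2
    ext i
    rw [← RingHom.mapMatrix_apply, ← RingHom.map_adjugate]
    simp [Matrix.mulVec, dotProduct]

/-- The zeros of `ω` are finite in number, so `ω` does not vanish along `{P = 0}` and only `h`
contributes. -/
theorem vanishingMult_eq (heq : φ.pullbackForm W = C h * W.form) {P : MvPolynomial (Fin 3) ℂ}
    (hP : Prime P) (hP0 : eval 0 P = 0) : φ.vanishingMult W P = emultiplicity P h := by
  have hCP : Prime (C P : SymForm 3) := (prime_C_iff _).2 hP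
  rw [vanishingMult, SymForm.ordAlong, heq, emultiplicity_mul hCP, emultiplicity_C_C,
    (emultiplicity_eq_zero (b := W.form)).2, add_zero]
  rintro ⟨g, hg⟩
  obtain ⟨x, u, hx, hxu⟩ := W.exists_val_ne_zero_of_prime P2Endo.id one_ne_zero hP hP0
  apply hxu
  have : (fun i => eval x (P2Endo.id.lift i)) = x := by
    ext i
    simp [P2Endo.id]
  rw [this, hg, SymForm.val_C_mul, hx, zero_mul]

/-- If the divisor of zeros of `φ^* ω` is `k Δ_φ`, then the critical values lie in the
discriminant. -/
theorem criticalValues_subset_discriminant (hk : 2 ≤ k) (hD : φ.degree ≠ 0)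
    (heq : φ.pullbackForm W = C h * W.form) {c : ℂ} (hc : φ.jacobian ^ k = h * C c) :
    φ.criticalValues ⊆ W.discriminant := by
  have hJ := pow_ne_zero k (φ.jacobian_ne_zero hD)
  have h0 : h ≠ 0 := left_ne_zero_of_mul (hc ▸ hJ)
  have hc0 : c ≠ 0 := by
    rintro rfl
    rw [hc, C_0, mul_zero] at hJ
    exact hJ rfl
  have key : ∀ x u : Fin 3 → ℂ, c * W.form.val (fun i => eval x (φ.lift i)) u =
      W.form.val x ((φ.jacobianMatrix.map (eval x)).adjugate.mulVec u) := by
    intro x u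
    have hadj : ∀ y, W.form.val y ((φ.jacobianMatrix.map (eval y)).adjugate.mulVec u) =
        eval y (W.form.subst X fun i => ∑ j, φ.jacobianMatrix.adjugate i j * C (u j)) := by
      intro y
      rw [SymForm.eval_subst]
      simp only [eval_C, eval_X, map_sum, map_mul]
      congr 1
      ext i
      rw [← RingHom.mapMatrix_apply, ← RingHom.map_adjugate]
      simp [Matrix.mulVec, dotProduct]
    -- The cancellation of `h` takes place between polynomials, because `h` vanishes at the critical
    -- points where the identity is needed.
    have hpoly : C c * W.form.subst φ.lift (fun i => C (u i)) =
        W.form.subst X fun i => ∑ j, φ.jacobianMatrix.adjugate i j * C (u j) := by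
      apply mul_left_cancel₀ h0
      refine MvPolynomial.funext fun y => ?_
      have hy := jacobian_pow_mul_val heq y u
      rw [← map_pow, hc, hadj] at hy
      rw [← mul_assoc, map_mul, SymForm.eval_subst, map_mul (eval y) h (SymForm.subst _ _ _), ← hy]
      simp only [eval_C]
    rw [hadj, ← hpoly, map_mul, eval_C, SymForm.eval_subst]
    simp only [eval_C]
  rintro _ ⟨p, hp, rfl⟩ ⟨l, hl, hind, hprod⟩
  obtain ⟨t, ht⟩ := Projectivization.exists_smul_eq_mk_rep ℂ _
    (φ.no_common_zero p.rep p.rep_nonzero)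
  have hdet : (φ.jacobianMatrix.map (eval p.rep)).det = 0 := by
    rw [← RingHom.mapMatrix_apply, ← RingHom.map_det]
    exact hp
  obtain ⟨m, w, hmw⟩ := Matrix.exists_adjugate_mulVec_eq_smul hdet
  refine LinearMap.not_linearIndependent_of_prod_eq_pow (m := m)
    -- The power of `t` accounts for the chosen representative of `φ.toFun p`. The remaining factors
    -- come from `ω(p)(m(u) w) = m(u)^k ω(p)(w)`.
    (c := (t : ℂ) ^ W.coeffDegree * c⁻¹ * W.form.val p.rep w) (fun i => (hl i).2) (fun u => ?_)
    ⟨0, by omega⟩ ⟨1, by omega⟩ (hind _ _ (by simp))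
  have hrep : (φ.toFun p).rep = (t : ℂ) • fun i => eval p.rep (φ.lift i) := ht.symm
  have hk := key p.rep u
  rw [hmw, SymForm.val_smul_right W.isTwistedSection.homogeneous] at hk
  rw [← hprod, hrep, SymForm.val_smul_left W.isTwistedSection.coeff_homogeneous]
  field_simp
  linear_combination hk

end P2Endo

/-! ### Proof of the proposition -/

theorem propositionp (k : ℕ) (hk : 1 ≤ k) (W : Web k) (φ : P2Endo)
    (hφ : ¬ φ.IsInvertible) (hW : φ.LeavesInvariant W) :
    (∃! n : ℕ, W.HasDegree n) ∧
    ∀ n : ℕ, W.HasDegree n →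
      n ≤ k ∧
      (n = k ↔
        ∀ (P : MvPolynomial (Fin 3) ℂ) (r : ℕ), Irreducible P → P.IsHomogeneous r →
          φ.vanishingMult W P = (k : ℕ∞) * φ.ordRamification P) ∧
      (2 ≤ k → n = k → φ.criticalValues ⊆ W.discriminant) := by
  obtain ⟨d, hd, hdeg⟩ := W.exists_hasDegree_iff
  refine ⟨⟨d, (hdeg d).2 rfl, fun n hn => (hdeg n).1 hn⟩, fun n hn => ?_⟩
  obtain rfl := (hdeg n).1 hn
  have hD0 := φ.degree_ne_zero_of_leavesInvariant W hk hW
  have hD1 : φ.degree ≠ 1 := fun h => hφ (φ.isInvertible_of_degree_eq_one h)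
  obtain ⟨h, h0, heq⟩ := hW
  obtain ⟨m, hm, hmdeg⟩ := P2Endo.exists_isHomogeneous_of_pullbackForm_eq h0 heq
  obtain ⟨g, hg⟩ := P2Endo.dvd_jacobian_pow hD0 h0 heq
  have hJ := pow_ne_zero k (φ.jacobian_ne_zero hD0)
  have hg0 : g ≠ 0 := right_ne_zero_of_mul (hg ▸ hJ)
  have hJhom := φ.jacobian_isHomogeneous.pow k
  obtain ⟨a, b, ha, hb, hab⟩ := (hg ▸ hJhom).exists_of_mul (hg ▸ hJ)
  have ham := ha.inj_right hm h0
  obtain ⟨t, ht⟩ : ∃ t, φ.degree = t + 2 := ⟨φ.degree - 2, by omega⟩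
  -- With `t + 1 = D - 1`, the degrees of `J^k` and `h` are `3(t + 1)k` and `(t + 1)(n + 2k)`. Their
  -- difference `b` is the degree of `g`.
  have hbal : b + (t + 1) * n = (t + 1) * k := by
    rw [ht, show t + 2 - 1 = t + 1 by omega, ← hd] at hmdeg
    rw [ht, show t + 2 - 1 = t + 1 by omega] at hab
    subst ham
    nlinarith
  have hnk : n ≤ k := Nat.le_of_mul_le_mul_left (by omega : (t + 1) * n ≤ (t + 1) * k) t.succ_pos
  have hconst : n = k → ∃ c : ℂ, g = C c := by
    rintro rfl
    obtain rfl : b = 0 := by omega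
    exact ⟨_, totalDegree_eq_zero_iff_eq_C.1 ((totalDegree_zero_iff_isHomogeneous _).2 hb)⟩
  have hmult : ∀ P : MvPolynomial (Fin 3) ℂ, Prime P →
      (k : ℕ∞) * φ.ordRamification P = emultiplicity P h + emultiplicity P g := by
    intro P hP
    rw [P2Endo.ordRamification, ← emultiplicity_pow hP, hg, emultiplicity_mul hP]
  refine ⟨hnk, ⟨fun hn P r hP hr => ?_, fun H => ?_⟩, fun hk2 hn => ?_⟩
  · obtain ⟨c, rfl⟩ := hconst hn
    obtain ⟨-, -, hP0⟩ := P2Endo.eval_zero_of_dvd hr hP.ne_zero hP.prime dvd_rfl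
    have hc : IsUnit (C c : MvPolynomial (Fin 3) ℂ) :=
      (isUnit_iff_ne_zero.2 fun h => hg0 (by rw [h, C_0])).map C
    rw [P2Endo.vanishingMult_eq heq hP.prime hP0, hmult P hP.prime,
      emultiplicity_of_isUnit_right hP.not_isUnit hc, add_zero]
  · have hu : IsUnit g := by
      by_contra hu
      obtain ⟨P, hP, hPg⟩ := WfDvdMonoid.exists_irreducible_factor hu hg0
      obtain ⟨r, hr, hP0⟩ := P2Endo.eval_zero_of_dvd hb hg0 hP.prime hPg
      have h1 := H P r hP hr
      rw [P2Endo.vanishingMult_eq heq hP.prime hP0, hmult P hP.prime] at h1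
      -- An irreducible factor `P` of `g` would add to the order of `h` in that of `J^k`. Finiteness
      -- of the former allows cancellation in `ℕ∞`.
      have hfin : FiniteMultiplicity P h := .of_not_isUnit hP.not_isUnit h0
      rw [hfin.emultiplicity_eq_multiplicity] at h1
      have h2 : emultiplicity P g = 0 :=
        ENat.add_right_injective_of_ne_top (ENat.natCast_ne_top _)
          (h1.symm.trans (add_zero _).symm)
      exact emultiplicity_eq_zero.1 h2 hPg
    have hb0 : b = 0 := by
      rw [(isUnit_iff_totalDegree_of_isReduced.1 hu).2.symm, hb.totalDegree hg0]
    rw [hb0, zero_add] at hbal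
    exact Nat.eq_of_mul_eq_mul_left t.succ_pos hbal
  · obtain ⟨c, rfl⟩ := hconst hn
    exact P2Endo.criticalValues_subset_discriminant hk2 hD0 heq hg

end
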